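/- Let $R$ be a complete discrete valuation ring with quotient field $K$ and maximal ideal $P=\pi R$, and let $\Lambda=(P^{\alpha_{ij}})_n\subseteq M_n(K)$ be a tiled order with exponent matrix $(\alpha_{ij})$, i.e. the $\alpha_{ij}$ are non-negative integers with $\alpha_{ii}=0$ and $\alpha_{ij}+\alpha_{jk}\ge\alpha_{ik}$ for all $i,j,k$. Assume that $\Lambda$ is basic, i.e. $\alpha_{ij}+\alpha_{ji}>0$ for $i\ne j$. Let $M_k$ be obtained from $\Lambda$ by replacing the $R$ in position $(k,k)$ by $P$; then $M_1,\dots,M_n$ are the distinct maximal two-sided ideals of $\Lambda$. The link graph $Q(\Lambda)$ is the quiver with vertices $1,\dots,n$ and an arrow from $i$ to $j$ if and only if $M_jM_i\ne M_j\cap M_i$; its automorphisms are identified with permutations of $\{1,\dots,n\}$. Call $\sigma\in\operatorname{Aut}(Q(\Lambda))$ liftable if there is $\varphi\in\operatorname{Aut}_R(\Lambda)$ with $\varphi(M_i)=M_{\sigma(i)}$ for all $i$. For $g\in GL_n(K)$ let $\iota_g$ denote the conjugation $y\mapsto g^{-1}yg$; write $\iota_g\in\operatorname{Aut}_R(\Lambda)$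 if $\iota_g$ restricts to an $R$-automorphism of $\Lambda$. Let $v(\sigma)$ be the permutation matrix with $v(\sigma)_{ij}=1$ if $j=\sigma(i)$ and $0$ otherwise, and $d(\mathbf x)=\operatorname{diag}(\pi^{x_1},\dots,\pi^{x_n})$ for $\mathbf x\in\mathbb Z^n$. For a permutation $\sigma$ consider the linear system $$x_i-x_j=\alpha_{ij}-\alpha_{\sigma(i)\sigma(j)}\qquad (1\le i,j\le n).\tag{1}$$ (a) $\sigma\in\operatorname{Aut}(Q(\Lambda))$ is liftable if and only if (1) has a solution $\mathbf x\in\mathbb Z^n$. (b) If $\sigma\in\operatorname{Aut}(Q(\Lambda))$ is liftable and $\mathbf x\in\mathbb Z^n$ satisfies the equations of (1) with $i<j$ (in particular, if $\mathbf x$ solves (1)), then $\iota_{d(\mathbf x)v(\sigma)}\in\operatorname{Aut}_R(\Lambda)$. (c) If $\varphi\in\operatorname{Aut}_R(\Lambda)$ is written as $\varphi=\iota_{u\,d\,v(\sigma)}$ with $u\in\Lambda^*$, $d=\operatorname{diag}(\pi^{d_1},\dots,\pi^{d_n})$, $d_i\in\mathbb Z$, and $\sigma\in S_n$, then $(d_1,\dots,d_n)$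 is a solution of (1). (d) The set $\mathcal O_\Lambda=\{\iota_{d(\mathbf x)v(\sigma)} : \sigma\in\operatorname{Aut}(Q(\Lambda))\text{ liftable},\ \mathbf x\in\mathbb Z^n\text{ a solution of (1)}\}$ is a subgroup of $\operatorname{Aut}_R(\Lambda)$, and $\operatorname{Aut}_R(\Lambda)=\operatorname{Inn}(\Lambda)\rtimes\mathcal O_\Lambda$ (internal semidirect product with $\operatorname{Inn}(\Lambda)$ normal). -/

import Mathlib

namespace TiledOrder

/-- An exponent matrix: nonnegative integers `α i j` with `α i i = 0` and
`α i k ≤ α i j + α j k`. -/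
structure ExponentMatrix (n : ℕ) where
  exp : Fin n → Fin n → ℕ
  diag : ∀ i, exp i i = 0
  triangle : ∀ i j k, exp i k ≤ exp i j + exp j k

section
variable (R K : Type*) [CommRing R] [IsLocalRing R] [Field K] [Algebra R K] {n : ℕ}

/-- `P ^ a`, viewed inside `K`, where `P` is the maximal ideal of `R`. -/
def primePow (a : ℕ) : Submodule R K :=
  Submodule.map (Algebra.linearMap R K) (IsLocalRing.maximalIdeal R ^ a)

/-- The `R`-lattice `(P ^ β i j)` of matrices whose `(i, j)` entry lies in `P ^ β i j`. -/
def entrywise (β : Fin n → Fin n → ℕ) : Submodule R (Matrix (Fin n) (Fin n) K) where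
  carrier := {A | ∀ i j, A i j ∈ primePow R K (β i j)}
  add_mem' hA hB i j := add_mem (hA i j) (hB i j)
  zero_mem' _ _ := zero_mem _
  smul_mem' r _ hA i j := Submodule.smul_mem _ r (hA i j)

variable {R K} in
theorem primePow_mul_mem {a b c : ℕ} (h : c ≤ a + b) {x y : K} (hx : x ∈ primePow R K a)
    (hy : y ∈ primePow R K b) : x * y ∈ primePow R K c := by
  obtain ⟨r, hr, rfl⟩ := hx
  obtain ⟨s, hs, rfl⟩ := hy
  refine ⟨r * s, Ideal.pow_le_pow_right h ?_, by simp⟩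
  rw [pow_add]
  exact Ideal.mul_mem_mul hr hs

/-- The tiled order `Λ = (P ^ α i j)` in `M_n(K)` with exponent matrix `α`. -/
def order (α : ExponentMatrix n) : Subalgebra R (Matrix (Fin n) (Fin n) K) where
  carrier := {A | ∀ i j, A i j ∈ primePow R K (α.exp i j)}
  add_mem' hA hB i j := add_mem (hA i j) (hB i j)
  mul_mem' {A B} hA hB i j := by
    rw [Matrix.mul_apply]
    exact sum_mem fun k _ => primePow_mul_mem (α.triangle i k j) (hA i k) (hB k j)
  algebraMap_mem' r i j := by
    rw [Matrix.algebraMap_matrix_apply]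
    split_ifs with h
    · subst h
      exact ⟨r, by simp [α.diag], rfl⟩
    · exact zero_mem _

/-- `M_k`: the order with the `R` in position `(k, k)` replaced by `P`. -/
def maxIdeal (α : ExponentMatrix n) (k : Fin n) : Submodule R (Matrix (Fin n) (Fin n) K) :=
  entrywise R K fun i j => if i = k ∧ j = k then 1 else α.exp i j

/-- Arrows of the link graph: `i → j` iff `M_j M_i ≠ M_j ∩ M_i`. The product is the additive span
of the products `a * b`. -/
def LinkArrow (α : ExponentMatrix n) (i j : Fin n) : Prop :=
  maxIdeal R K α j * maxIdeal R K α i ≠ maxIdeal R K α j ⊓ maxIdeal R K α i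

/-- `Aut(Q(Λ))`: permutations of the vertices of the link graph that preserve and reflect arrows
(there is at most one arrow from `i` to `j`). -/
abbrev LinkAut (α : ExponentMatrix n) : Type := LinkArrow R K α ≃r LinkArrow R K α

/-- `Aut_R(Λ)`. -/
abbrev Aut (α : ExponentMatrix n) : Type _ := order R K α ≃ₐ[R] order R K α

/-- `Inn(Λ)`: the automorphisms given by conjugation with units of `Λ`. -/
def inn (α : ExponentMatrix n) : Subgroup (Aut R K α) :=
  (MulSemiringAction.toAlgAut (ConjAct (order R K α)ˣ) R (order R K α)).range

variable {R K}

/-- `φ` induces the permutation `σ` on the maximal ideals: `φ(M_i) = M_{σ(i)}` for all `i`. -/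
def Induces {α : ExponentMatrix n} (φ : Aut R K α) (σ : Equiv.Perm (Fin n)) : Prop :=
  ∀ i, ∀ a : order R K α,
    (φ a : Matrix (Fin n) (Fin n) K) ∈ maxIdeal R K α (σ i) ↔
      (a : Matrix (Fin n) (Fin n) K) ∈ maxIdeal R K α i

/-- An automorphism of the link graph is liftable if it is induced by some `φ ∈ Aut_R(Λ)`. -/
def Liftable {α : ExponentMatrix n} (σ : LinkAut R K α) : Prop :=
  ∃ φ : Aut R K α, Induces φ σ.toEquiv

/-- `φ = ι_g` on `Λ`, where `g ∈ GL_n(K)` and `ι_g(y) = g⁻¹ y g`. -/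
def IsConjBy {α : ExponentMatrix n} (φ : Aut R K α) (g : Matrix (Fin n) (Fin n) K) : Prop :=
  IsUnit g ∧ ∀ a : order R K α, (φ a : Matrix (Fin n) (Fin n) K) = g⁻¹ * a * g

variable (K) in
/-- `d(x) = diag(π ^ x_1, …, π ^ x_n)`. -/
def diagPow (ϖ : R) (x : Fin n → ℤ) : Matrix (Fin n) (Fin n) K :=
  Matrix.diagonal fun i => algebraMap R K ϖ ^ x i

end

/-- The linear system `x_i - x_j = α_{ij} - α_{σ(i)σ(j)}`, for all `i` and `j`. -/
def Solves {n : ℕ} (α : ExponentMatrix n) (σ : Equiv.Perm (Fin n)) (x : Fin n → ℤ) : Prop :=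
  ∀ i j, x i - x j = (α.exp i j : ℤ) - (α.exp (σ i) (σ j) : ℤ)

/-- The order is basic: `α i j + α j i > 0` for `i ≠ j`, i.e. its columns are pairwise
non-isomorphic, so that `M_1, …, M_n` are distinct maximal two-sided ideals. -/
def ExponentMatrix.IsBasic {n : ℕ} (α : ExponentMatrix n) : Prop :=
  ∀ i j, i ≠ j → 0 < α.exp i j + α.exp j i

/-- The set `O_Λ = {ι_{d(x)v(σ)} : σ liftable, x a solution of the system for σ}`, where `v(σ)` is
the permutation matrix whose `(i, j)` entry is `1` if `j = σ(i)` and `0` otherwise. -/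
def liftSet {R : Type*} (K : Type*) [CommRing R] [IsLocalRing R] [Field K] [Algebra R K] {n : ℕ}
    (ϖ : R) (α : ExponentMatrix n) : Set (Aut R K α) :=
  {φ | ∃ σ : LinkAut R K α, Liftable σ ∧ ∃ x : Fin n → ℤ, Solves α σ.toEquiv x ∧
    IsConjBy φ (diagPow K ϖ x * Equiv.Perm.permMatrix K σ.toEquiv)}

end TiledOrder

open TiledOrder

/-!
The diagonal entries modulo `P` give `n` ring homomorphisms `Λ → R / P` with kernels
`M_1, …, M_n`. Up to elements of `P`, the determinant of an element of `Λ` is the product of its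
diagonal entries, since a nontrivial permutation contributes a product of positive valuation; as
`Λ` contains the adjugates of its elements, it follows that an element of `Λ` with all diagonal
residues nonzero is a unit.

Let `φ` be an automorphism and `e_i` the diagonal idempotents. Each of the `n` residue maps is `1`
on exactly one of the idempotents `f_i = φ⁻¹(e_i)`, and no `f_i` is killed by all of them, so this
matches the `e_k` with the `f_i` by a permutation `τ`. The element `∑ f_{τ(k)} e_k` is then a unit
that conjugates one family to the other. Hence, up to an inner automorphism, `φ` permutes the
`e_i`; such a `φ` is conjugation by a monomial matrix, and after moving units of `R` into `Λ^*` by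
`d(x) v(σ)`.

Finally, comparing valuations in `d(x) v(σ) φ(a) = a d(x) v(σ)` entry by entry, for `φ` and for its
inverse, shows that conjugation by `d(x) v(σ)` preserves `Λ` exactly when `x` solves the system.
The factorization is unique modulo inner automorphisms because these fix every `M_i`.
-/

namespace TiledOrder

section PrimePow

variable {R K : Type*} [CommRing R] [IsLocalRing R] [Field K] [Algebra R K]

theorem primePow_antitone : Antitone (primePow R K) := fun _ _ h =>
  Submodule.map_mono (Ideal.pow_le_pow_right h)

theorem mem_primePow_zero_iff {x : K} : x ∈ primePow R K 0 ↔ ∃ r, algebraMap R K r = x := by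
  simp [primePow]

theorem algebraMap_mem_primePow_zero (r : R) : algebraMap R K r ∈ primePow R K 0 :=
  mem_primePow_zero_iff.2 ⟨r, rfl⟩

theorem prod_mem_primePow {ι : Type*} {s : Finset ι} {a : ι → ℕ} {x : ι → K}
    (h : ∀ i ∈ s, x i ∈ primePow R K (a i)) : ∏ i ∈ s, x i ∈ primePow R K (∑ i ∈ s, a i) := by
  classical
  induction s using Finset.induction_on with
  | empty => simpa using algebraMap_mem_primePow_zero (K := K) (1 : R)
  | insert i s hi ih =>
    rw [Finset.prod_insert hi, Finset.sum_insert hi]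
    exact primePow_mul_mem le_rfl (h i (Finset.mem_insert_self i s))
      (ih fun j hj => h j (Finset.mem_insert_of_mem hj))

theorem algebraMap_mem_primePow_one_iff [FaithfulSMul R K] {r : R} :
    algebraMap R K r ∈ primePow R K 1 ↔ r ∈ IsLocalRing.maximalIdeal R := by
  rw [primePow, pow_one]
  exact (FaithfulSMul.algebraMap_injective R K).mem_set_image

theorem one_notMem_primePow_one [FaithfulSMul R K] : (1 : K) ∉ primePow R K 1 := by
  rw [← map_one (algebraMap R K), algebraMap_mem_primePow_one_iff, IsLocalRing.mem_maximalIdeal]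
  exact one_notMem_nonunits

end PrimePow

section Uniformizer

variable {R K : Type*} [CommRing R] [Field K] [Algebra R K] {ϖ : R}

theorem algebraMap_ne_zero_of_irreducible [FaithfulSMul R K] (hϖ : Irreducible ϖ) :
    algebraMap R K ϖ ≠ 0 :=
  (map_ne_zero_iff _ (FaithfulSMul.algebraMap_injective R K)).2 hϖ.ne_zero

variable [IsDomain R] [IsDiscreteValuationRing R]

theorem mem_primePow_iff_exists (hϖ : Irreducible ϖ) {a : ℕ} {x : K} :
    x ∈ primePow R K a ↔ ∃ r : R, x = algebraMap R K ϖ ^ a * algebraMap R K r := by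
  rw [primePow, hϖ.maximalIdeal_eq, Ideal.span_singleton_pow]
  simp [Ideal.mem_span_singleton', eq_comm, mul_comm]

theorem pow_mem_primePow (hϖ : Irreducible ϖ) (a : ℕ) : algebraMap R K ϖ ^ a ∈ primePow R K a :=
  (mem_primePow_iff_exists hϖ).2 ⟨1, by simp⟩

variable [FaithfulSMul R K]

theorem zpow_mul_mem_primePow_iff (hϖ : Irreducible ϖ) {a b : ℕ} {z : ℤ} (h : (b : ℤ) = z + a)
    {x : K} : algebraMap R K ϖ ^ z * x ∈ primePow R K b ↔ x ∈ primePow R K a := by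
  have h0 := algebraMap_ne_zero_of_irreducible (K := K) hϖ
  simp only [mem_primePow_iff_exists hϖ, ← zpow_natCast, h, zpow_add₀ h0, mul_assoc,
    mul_right_inj' (zpow_ne_zero z h0)]

theorem zpow_mem_primePow_iff (hϖ : Irreducible ϖ) {a : ℕ} {z : ℤ} :
    algebraMap R K ϖ ^ z ∈ primePow R K a ↔ (a : ℤ) ≤ z := by
  constructor
  · intro h
    by_contra! hlt
    obtain ⟨b, hb⟩ := Int.eq_ofNat_of_zero_le (show 0 ≤ a - z by omega)
    have h1 : (1 : K) ∈ primePow R K b := by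
      rw [← zpow_mul_mem_primePow_iff hϖ (show (a : ℤ) = z + b by omega), mul_one]
      exact h
    exact one_notMem_primePow_one (primePow_antitone (by omega) h1)
  · intro h
    obtain ⟨b, rfl⟩ := Int.eq_ofNat_of_zero_le (show 0 ≤ z by omega)
    rw [zpow_natCast]
    exact primePow_antitone (by omega) (pow_mem_primePow hϖ b)

end Uniformizer

section Permutations

variable {n : ℕ} {α : ExponentMatrix n}

/- Summing `α j k ≤ α j (σ k) + α (σ k) k` over `k ≠ j`, everything cancels except
`α j (σ j)`. -/
theorem ExponentMatrix.exp_apply_le_sum_erase (α : ExponentMatrix n) (σ : Equiv.Perm (Fin n))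
    (j : Fin n) : α.exp j (σ j) ≤ ∑ k ∈ Finset.univ.erase j, α.exp (σ k) k := by
  have htri : ∑ k ∈ Finset.univ.erase j, α.exp j k ≤
      ∑ k ∈ Finset.univ.erase j, α.exp j (σ k) + ∑ k ∈ Finset.univ.erase j, α.exp (σ k) k := by
    rw [← Finset.sum_add_distrib]
    exact Finset.sum_le_sum fun k _ => α.triangle j (σ k) k
  have hperm : ∑ k, α.exp j (σ k) = ∑ k, α.exp j k := Equiv.sum_comp σ _
  rw [← Finset.add_sum_erase _ _ (Finset.mem_univ j),
    ← Finset.add_sum_erase _ _ (Finset.mem_univ j), α.diag] at hperm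
  omega

theorem ExponentMatrix.IsBasic.sum_perm_pos (hα : α.IsBasic) {σ : Equiv.Perm (Fin n)}
    (hσ : σ ≠ 1) : 0 < ∑ k, α.exp (σ k) k := by
  obtain ⟨j, hj⟩ := not_forall.1 (mt Equiv.ext hσ)
  rw [← Finset.add_sum_erase _ _ (Finset.mem_univ j)]
  have := α.exp_apply_le_sum_erase σ j
  have := hα (σ j) j hj
  omega

end Permutations

section Determinant

variable {R K : Type*} [CommRing R] [IsLocalRing R] [Field K] [Algebra R K] {n : ℕ}
  {α : ExponentMatrix n}

theorem adjugate_mem_order {A : Matrix (Fin n) (Fin n) K} (hA : A ∈ order R K α) :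
    A.adjugate ∈ order R K α := by
  intro i j
  rw [Matrix.adjugate_apply, Matrix.det_apply]
  refine sum_mem fun σ _ => ?_
  rw [Units.smul_def]
  refine zsmul_mem ?_ _
  by_cases hij : σ i = j
  · subst hij
    have hrest : ∀ k ∈ Finset.univ.erase i,
        A.updateRow (σ i) (Pi.single i 1) (σ k) k ∈ primePow R K (α.exp (σ k) k) := by
      intro k hk
      rw [Matrix.updateRow_ne (σ.injective.ne (Finset.ne_of_mem_erase hk))]
      exact hA (σ k) k
    rw [← Finset.mul_prod_erase _ _ (Finset.mem_univ i), Matrix.updateRow_self, Pi.single_eq_same,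
      one_mul]
    exact primePow_antitone (α.exp_apply_le_sum_erase σ i) (prod_mem_primePow hrest)
  · have hzero : ∏ k, A.updateRow j (Pi.single i 1) (σ k) k = 0 := by
      refine Finset.prod_eq_zero (Finset.mem_univ (σ.symm j)) ?_
      rw [σ.apply_symm_apply, Matrix.updateRow_self]
      exact Pi.single_eq_of_ne (fun h => hij (σ.symm_apply_eq.1 h).symm) _
    rw [hzero]
    exact zero_mem _

theorem det_sub_prod_diag_mem_primePow_one (hα : α.IsBasic) {A : Matrix (Fin n) (Fin n) K}
    (hA : A ∈ order R K α) : A.det - ∏ k, A k k ∈ primePow R K 1 := by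
  rw [Matrix.det_apply, ← Finset.add_sum_erase _ _ (Finset.mem_univ 1), Equiv.Perm.sign_one,
    one_smul]
  simp only [Equiv.Perm.one_apply, add_sub_cancel_left]
  refine sum_mem fun σ hσ => ?_
  rw [Units.smul_def]
  refine zsmul_mem (primePow_antitone ?_ (prod_mem_primePow fun k _ => hA (σ k) k)) _
  exact hα.sum_perm_pos (Finset.ne_of_mem_erase hσ)

end Determinant

section DiagonalResidue

variable {R K : Type*} [CommRing R] [IsLocalRing R] [Field K] [Algebra R K]
  {n : ℕ} {α : ExponentMatrix n}

theorem exists_algebraMap_eq_diag (a : order R K α) (k : Fin n) :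
    ∃ r, algebraMap R K r = (a : Matrix (Fin n) (Fin n) K) k k :=
  mem_primePow_zero_iff.1 (primePow_antitone (Nat.zero_le _) (a.2 k k))

/-- The `(k, k)` entry of an element of the order, as an element of `R`. -/
noncomputable def diagEntry (k : Fin n) (a : order R K α) : R :=
  (exists_algebraMap_eq_diag a k).choose

theorem algebraMap_diagEntry (k : Fin n) (a : order R K α) :
    algebraMap R K (diagEntry k a) = (a : Matrix (Fin n) (Fin n) K) k k :=
  (exists_algebraMap_eq_diag a k).choose_spec

theorem mul_diag_sub_mem_primePow_one (hα : α.IsBasic) (a b : order R K α) (k : Fin n) :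
    (a * b : Matrix (Fin n) (Fin n) K) k k -
      (a : Matrix (Fin n) (Fin n) K) k k * (b : Matrix (Fin n) (Fin n) K) k k ∈
        primePow R K 1 := by
  rw [Matrix.mul_apply, ← Finset.add_sum_erase _ _ (Finset.mem_univ k), add_sub_cancel_left]
  exact sum_mem fun l hl =>
    primePow_mul_mem (hα k l (Finset.ne_of_mem_erase hl).symm) (a.2 k l) (b.2 l k)

theorem mem_maxIdeal_iff {k : Fin n} {a : order R K α} :
    (a : Matrix (Fin n) (Fin n) K) ∈ maxIdeal R K α k ↔
      (a : Matrix (Fin n) (Fin n) K) k k ∈ primePow R K 1 := by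
  refine ⟨fun h => by simpa using h k k, fun h i j => ?_⟩
  dsimp only
  split_ifs with hij
  · rwa [hij.1, hij.2]
  · exact a.2 i j

variable [FaithfulSMul R K]

theorem diagEntry_eq {k : Fin n} {a : order R K α} {r : R}
    (h : (a : Matrix (Fin n) (Fin n) K) k k = algebraMap R K r) : diagEntry k a = r :=
  FaithfulSMul.algebraMap_injective R K ((algebraMap_diagEntry k a).trans h)

/-- The ring homomorphism `Λ → R / P` that sends a matrix to its `(k, k)` entry modulo `P`; its
kernel is `M_k`. Multiplicativity needs `Λ` to be basic. -/
noncomputable def diagResidue (hα : α.IsBasic) (k : Fin n) :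
    order R K α →+* IsLocalRing.ResidueField R where
  toFun a := IsLocalRing.residue R (diagEntry k a)
  map_one' := by rw [diagEntry_eq (r := 1) (by simp), map_one]
  map_zero' := by rw [diagEntry_eq (r := 0) (by simp), map_zero]
  map_add' a b := by
    rw [← map_add, diagEntry_eq (r := diagEntry k a + diagEntry k b)
      (by simp [algebraMap_diagEntry])]
  map_mul' a b := by
    rw [← map_mul, ← sub_eq_zero, ← map_sub, IsLocalRing.residue_eq_zero_iff,
      ← algebraMap_mem_primePow_one_iff (K := K)]
    simpa [algebraMap_diagEntry] using mul_diag_sub_mem_primePow_one hα a b k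

theorem diagResidue_apply (hα : α.IsBasic) (k : Fin n) (a : order R K α) :
    diagResidue hα k a = IsLocalRing.residue R (diagEntry k a) := rfl

theorem diagResidue_eq_zero_iff (hα : α.IsBasic) {k : Fin n} {a : order R K α} :
    diagResidue hα k a = 0 ↔ (a : Matrix (Fin n) (Fin n) K) ∈ maxIdeal R K α k := by
  rw [mem_maxIdeal_iff, ← algebraMap_diagEntry, algebraMap_mem_primePow_one_iff,
    diagResidue_apply, IsLocalRing.residue_eq_zero_iff]

theorem exists_algebraMap_eq_det (hα : α.IsBasic) (a : order R K α) :
    ∃ r, algebraMap R K r = (a : Matrix (Fin n) (Fin n) K).det ∧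
      IsLocalRing.residue R r = ∏ k, diagResidue hα k a := by
  obtain ⟨p, hp, hdet⟩ := det_sub_prod_diag_mem_primePow_one hα a.2
  rw [pow_one] at hp
  refine ⟨p + ∏ k, diagEntry k a, ?_, ?_⟩
  · simpa [algebraMap_diagEntry, ← eq_sub_iff_add_eq] using hdet
  · rw [map_add, (IsLocalRing.residue_eq_zero_iff p).2 hp, zero_add, map_prod]
    rfl

/- The determinant is then a unit of `R`, and `Λ` is closed under adjugates. -/
theorem isUnit_of_diagResidue_ne_zero (hα : α.IsBasic) {a : order R K α}
    (ha : ∀ k, diagResidue hα k a ≠ 0) : IsUnit a := by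
  obtain ⟨r, hr, hres⟩ := exists_algebraMap_eq_det hα a
  have hunit : IsUnit r := by
    rw [← IsLocalRing.residue_ne_zero_iff_isUnit, hres]
    exact Finset.prod_ne_zero_iff.2 fun k _ => ha k
  obtain ⟨w, rfl⟩ := hunit
  let adj : order R K α := ⟨_, adjugate_mem_order a.2⟩
  have hmul : a * adj = (w : R) • 1 := Subtype.ext <| by
    simpa [adj, Matrix.mul_adjugate, hr] using (algebraMap_smul K (w : R) _)
  have hmul' : adj * a = (w : R) • 1 := Subtype.ext <| by
    simpa [adj, Matrix.adjugate_mul, hr] using (algebraMap_smul K (w : R) _)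
  refine ⟨⟨a, (↑w⁻¹ : R) • adj, ?_, ?_⟩, rfl⟩
  · rw [mul_smul_comm, hmul, smul_smul, Units.inv_mul, one_smul]
  · rw [smul_mul_assoc, hmul', smul_smul, Units.inv_mul, one_smul]

end DiagonalResidue

section Idempotents

variable {ι S : Type*} [Fintype ι] [Ring S]

theorem mul_sum_mul_eq_sum_mul_mul {e f : ι → S} (he : OrthogonalIdempotents e)
    (hf : OrthogonalIdempotents f) (i : ι) :
    f i * ∑ k, f k * e k = (∑ k, f k * e k) * e i := by
  classical
  simp [Finset.mul_sum, Finset.sum_mul, mul_assoc, he.mul_eq, ← mul_assoc (f i), hf.mul_eq]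

variable {D : Type*} [Ring D] [IsDomain D]

theorem exists_perm_map_eq_one {ρ : ι → S →+* D} (hρ : ∀ a, (∀ k, ρ k a ≠ 0) → IsUnit a)
    {f : ι → S} (hf : CompleteOrthogonalIdempotents f) (hf0 : ∀ i, f i ≠ 0) :
    ∃ τ : Equiv.Perm ι, ∀ k, ρ k (f (τ k)) = 1 := by
  have hex : ∀ k, ∃ i, ρ k (f i) ≠ 0 := by
    intro k
    by_contra! h
    have := congrArg (ρ k) hf.complete
    simp [h] at this
  choose τ hτ using hex
  have hone : ∀ k, ρ k (f (τ k)) = 1 := fun k =>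
    (IsIdempotentElem.iff_eq_zero_or_one.1 ((hf.idem _).map (ρ k))).resolve_left (hτ k)
  have hsurj : Function.Surjective τ := by
    intro i
    by_contra! h
    have hz : ∀ k, ρ k (f i) = 0 := fun k => by
      simpa [hone] using congrArg (ρ k) (hf.ortho (h k))
    have hu : IsUnit (1 - f i) := hρ _ fun k => by simp [hz]
    exact hf0 i (hu.mul_left_eq_zero.1 (hf.idem i).mul_one_sub_self)
  exact ⟨Equiv.ofBijective τ ⟨Finite.injective_iff_surjective.2 hsurj, hsurj⟩, hone⟩

theorem exists_unit_mul_eq_mul {ρ : ι → S →+* D} (hρ : ∀ a, (∀ k, ρ k a ≠ 0) → IsUnit a)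
    {e f : ι → S} (he : OrthogonalIdempotents e) (he1 : ∀ k, ρ k (e k) = 1)
    (hf : CompleteOrthogonalIdempotents f) (hf0 : ∀ i, f i ≠ 0) :
    ∃ (u : Sˣ) (τ : Equiv.Perm ι), ∀ k, f (τ k) * u = u * e k := by
  obtain ⟨τ, hτ⟩ := exists_perm_map_eq_one hρ hf hf0
  have hfτ : OrthogonalIdempotents (f ∘ τ) := hf.embedding τ.toEmbedding
  have hu : IsUnit (∑ k, (f ∘ τ) k * e k) := hρ _ fun l => by
    have hoff : ∀ k, k ≠ l → ρ l (f (τ k)) = 0 := fun k hk => by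
      simpa [hτ] using congrArg (ρ l) (hfτ.ortho hk)
    rw [map_sum, Finset.sum_eq_single l (fun k _ hk => by simp [hoff k hk]) (by simp)]
    simp [hτ, he1]
  obtain ⟨u, hu⟩ := hu
  exact ⟨u, τ, fun k => hu ▸ mul_sum_mul_eq_sum_mul_mul he hfτ k⟩

end Idempotents

section Monomial

variable {ι K : Type*} [Fintype ι] [DecidableEq ι] [Field K]

theorem isUnit_diagonal_mul_permMatrix_iff {c : ι → K} {σ : Equiv.Perm ι} :
    IsUnit (Matrix.diagonal c * σ.permMatrix K) ↔ ∀ i, c i ≠ 0 := by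
  have hdet : IsUnit (σ.permMatrix K).det := by
    rw [Matrix.det_permutation]
    exact (Equiv.Perm.sign σ).isUnit.map (Int.castRingHom K)
  rw [Matrix.isUnit_iff_isUnit_det, Matrix.det_mul, hdet.mul_right_iff, Matrix.det_diagonal,
    isUnit_iff_ne_zero, Finset.prod_ne_zero_iff]
  simp

theorem diagonal_mul_permMatrix_mul_eq_iff {c : ι → K} {σ : Equiv.Perm ι} {A B : Matrix ι ι K} :
    Matrix.diagonal c * σ.permMatrix K * B = A * (Matrix.diagonal c * σ.permMatrix K) ↔
      ∀ i j, c i * B (σ i) (σ j) = A i j * c j := by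
  rw [← Matrix.ext_iff]
  refine forall_congr' fun i => ?_
  rw [← σ.forall_congr_right]
  refine forall_congr' fun j => ?_
  rw [mul_assoc, ← mul_assoc A, PEquiv.toMatrix_toPEquiv_mul, PEquiv.mul_toMatrix_toPEquiv]
  simp [Matrix.diagonal_mul, Matrix.mul_diagonal]

variable {R : Type*} [CommRing R] [Algebra R K] {n : ℕ} {ϖ : R}

theorem isUnit_diagPow_mul_permMatrix [FaithfulSMul R K] (hϖ : Irreducible ϖ) (x : Fin n → ℤ)
    (σ : Equiv.Perm (Fin n)) : IsUnit (diagPow K ϖ x * σ.permMatrix K) :=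
  isUnit_diagonal_mul_permMatrix_iff.2 fun i =>
    zpow_ne_zero (x i) (algebraMap_ne_zero_of_irreducible hϖ)

theorem diagPow_mul_permMatrix_mul [FaithfulSMul R K] (hϖ : Irreducible ϖ) (x y : Fin n → ℤ)
    (σ τ : Equiv.Perm (Fin n)) :
    diagPow K ϖ x * σ.permMatrix K * (diagPow K ϖ y * τ.permMatrix K) =
      diagPow K ϖ (x + y ∘ σ) * (τ * σ).permMatrix K := by
  have h0 := algebraMap_ne_zero_of_irreducible (K := K) hϖ
  have hcomm : diagPow K ϖ x * σ.permMatrix K * diagPow K ϖ y =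
      diagPow K ϖ (x + y ∘ σ) * σ.permMatrix K := by
    rw [diagPow, diagPow, diagPow, mul_assoc, PEquiv.toMatrix_toPEquiv_mul]
    ext i j
    by_cases h : σ i = j
    · subst h
      simp [Matrix.diagonal_mul, PEquiv.toMatrix_apply, zpow_add₀ h0]
    · simp [Matrix.diagonal_mul, PEquiv.toMatrix_apply, h]
  rw [← mul_assoc, hcomm, mul_assoc, Matrix.permMatrix_mul]

theorem inv_diagPow_mul_permMatrix [FaithfulSMul R K] (hϖ : Irreducible ϖ) (x : Fin n → ℤ)
    (σ : Equiv.Perm (Fin n)) : (diagPow K ϖ x * σ.permMatrix K)⁻¹ =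
      diagPow K ϖ (-x ∘ σ.symm) * σ⁻¹.permMatrix K := by
  refine Matrix.inv_eq_right_inv ?_
  rw [diagPow_mul_permMatrix_mul hϖ, inv_mul_cancel, Matrix.permMatrix_one, mul_one]
  simp [diagPow, Function.comp_def]

end Monomial

section Conjugation

variable {R K : Type*} [CommRing R] [IsLocalRing R] [Field K] [Algebra R K] {n : ℕ}
  {α : ExponentMatrix n} {φ ψ : Aut R K α} {g h : Matrix (Fin n) (Fin n) K}

theorem isConjBy_iff : IsConjBy φ g ↔
    IsUnit g ∧ ∀ a : order R K α, g * (φ a : Matrix (Fin n) (Fin n) K) = a * g := by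
  refine and_congr_right fun hg => forall_congr' fun a => ?_
  have := hg.invertible
  rw [mul_assoc, ← Matrix.mul_right_inj_of_invertible g, Matrix.mul_inv_cancel_left_of_invertible]

theorem isConjBy_one : IsConjBy (1 : Aut R K α) 1 :=
  isConjBy_iff.2 ⟨isUnit_one, fun _ => (one_mul _).trans (mul_one _).symm⟩

theorem IsConjBy.mul (hφ : IsConjBy φ g) (hψ : IsConjBy ψ h) : IsConjBy (φ * ψ) (h * g) := by
  refine isConjBy_iff.2 ⟨hψ.1.mul hφ.1, fun a => ?_⟩
  rw [AlgEquiv.mul_apply, mul_assoc, (isConjBy_iff.1 hφ).2, ← mul_assoc, (isConjBy_iff.1 hψ).2,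
    mul_assoc]

theorem IsConjBy.inv (hφ : IsConjBy φ g) : IsConjBy φ⁻¹ g⁻¹ := by
  refine ⟨(Matrix.isUnit_nonsing_inv_iff).2 hφ.1, fun a => ?_⟩
  have := hφ.1.invertible
  have h := (isConjBy_iff.1 hφ).2 (φ⁻¹ a)
  rw [AlgEquiv.aut_inv, AlgEquiv.apply_symm_apply] at h
  rw [Matrix.inv_inv_of_invertible, h, Matrix.mul_inv_cancel_right_of_invertible,
    AlgEquiv.aut_inv]

theorem exists_isConjBy (hg : IsUnit g)
    (hmem : ∀ A B, g * B = A * g → (B ∈ order R K α ↔ A ∈ order R K α)) :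
    ∃ φ : Aut R K α, IsConjBy φ g := by
  obtain ⟨g, rfl⟩ := hg
  let e : Matrix (Fin n) (Fin n) K ≃ₐ[R] Matrix (Fin n) (Fin n) K :=
    MulSemiringAction.toAlgEquiv R _ (ConjAct.toConjAct g⁻¹)
  have he : ∀ A, e A = (g : Matrix (Fin n) (Fin n) K)⁻¹ * A * g := fun A => by
    simp [e, ConjAct.units_smul_def, Matrix.coe_units_inv]
  have hmem' : ∀ A, e A ∈ order R K α ↔ A ∈ order R K α := fun A =>
    hmem A (e A) <| by
      rw [he, mul_assoc, Matrix.mul_nonsing_inv_cancel_left _ _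
        ((Matrix.isUnit_iff_isUnit_det _).1 g.isUnit)]
  have hmap : (order R K α).map (e : Matrix (Fin n) (Fin n) K →ₐ[R] _) = order R K α := by
    ext B
    rw [Subalgebra.mem_map]
    constructor
    · rintro ⟨A, hA, rfl⟩
      exact (hmem' A).2 hA
    · exact fun hB => ⟨e.symm B, (hmem' _).1 (by rwa [e.apply_symm_apply]),
        e.apply_symm_apply B⟩
  exact ⟨(e.subalgebraMap (order R K α)).trans (Subalgebra.equivOfEq _ _ hmap), g.isUnit,
    fun a => he a⟩

theorem coe_units_inv_order (u : (order R K α)ˣ) :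
    ((↑u⁻¹ : order R K α) : Matrix (Fin n) (Fin n) K) = (u : order R K α).1⁻¹ :=
  (Matrix.inv_eq_left_inv (congrArg Subtype.val u.inv_mul)).symm

theorem isConjBy_unit_iff {u : (order R K α)ˣ} :
    IsConjBy φ (u : order R K α) ↔ ∀ a, φ a = ↑u⁻¹ * a * u := by
  have hu : IsUnit (u : order R K α).1 := u.isUnit.map (order R K α).val
  rw [IsConjBy, and_iff_right hu]
  simp [Subtype.ext_iff, coe_units_inv_order]

theorem mem_inn_iff : φ ∈ inn R K α ↔ ∃ u : (order R K α)ˣ, IsConjBy φ (u : order R K α) := by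
  simp only [isConjBy_unit_iff]
  constructor
  · rintro ⟨u, rfl⟩
    exact ⟨(ConjAct.ofConjAct u)⁻¹, fun a => by simp [ConjAct.units_smul_def]⟩
  · rintro ⟨u, hu⟩
    exact ⟨ConjAct.toConjAct u⁻¹, AlgEquiv.ext fun a => by simp [ConjAct.units_smul_def, hu]⟩

theorem exists_isConjBy_unit (u : (order R K α)ˣ) :
    ∃ ι : Aut R K α, IsConjBy ι (u : order R K α) :=
  ⟨MulSemiringAction.toAlgAut _ R _ (ConjAct.toConjAct u⁻¹),
    isConjBy_unit_iff.2 fun a => by simp [ConjAct.units_smul_def]⟩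

theorem inn_normal (α : ExponentMatrix n) : (inn R K α).Normal := by
  refine ⟨fun ι hι φ => ?_⟩
  obtain ⟨u, hu⟩ := mem_inn_iff.1 hι
  refine mem_inn_iff.2 ⟨Units.map (φ : order R K α →* order R K α) u,
    isConjBy_unit_iff.2 fun a => ?_⟩
  rw [AlgEquiv.mul_apply, AlgEquiv.mul_apply, isConjBy_unit_iff.1 hu, map_mul, map_mul,
    AlgEquiv.aut_inv, AlgEquiv.apply_symm_apply]
  rfl

theorem IsConjBy.exists_eq_mul_inn {u : (order R K α)ˣ} (hφ : IsConjBy φ ((u : order R K α) * g)) :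
    ∃ (θ : Aut R K α) (ι : Aut R K α), IsConjBy θ g ∧ ι ∈ inn R K α ∧ φ = θ * ι := by
  obtain ⟨ι, hι⟩ := exists_isConjBy_unit u
  refine ⟨φ * ι⁻¹, ι, ?_, mem_inn_iff.2 ⟨u, hι⟩, (inv_mul_cancel_right φ ι).symm⟩
  have h := hφ.mul hι.inv
  have := hι.1.invertible
  rwa [Matrix.inv_mul_cancel_left_of_invertible] at h

theorem IsConjBy.mul_apply_apply {c : Fin n → K} {σ : Equiv.Perm (Fin n)}
    (hφ : IsConjBy φ (Matrix.diagonal c * σ.permMatrix K)) (a : order R K α) (i j : Fin n) :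
    c i * (φ a : Matrix (Fin n) (Fin n) K) (σ i) (σ j) =
      (a : Matrix (Fin n) (Fin n) K) i j * c j :=
  diagonal_mul_permMatrix_mul_eq_iff.1 ((isConjBy_iff.1 hφ).2 a) i j

end Conjugation

section DiagonalMatrices

variable {R K : Type*} [CommRing R] [IsLocalRing R] [Field K] [Algebra R K] {n : ℕ}
  {α : ExponentMatrix n}

theorem exists_apply_eq {i j : Fin n} {x : K} (hx : x ∈ primePow R K (α.exp i j)) :
    ∃ a : order R K α, a.1 i j = x := by
  refine ⟨⟨Matrix.single i j x, fun p q => ?_⟩, Matrix.single_apply_same i j x⟩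
  rw [Matrix.single_apply]
  split_ifs with h
  · rwa [← h.1, ← h.2]
  · exact zero_mem _

variable (R K α) in
/-- The inclusion of the diagonal matrices over `R` into the order. -/
def diagHom : (Fin n → R) →ₐ[R] order R K α :=
  ((Matrix.diagonalAlgHom R).comp ((Algebra.ofId R K).compLeft (Fin n))).codRestrict _ <| by
    intro r i j
    by_cases h : i = j
    · subst h
      simpa [α.diag] using algebraMap_mem_primePow_zero (r i)
    · simp [h]

theorem coe_diagHom (r : Fin n → R) :
    (diagHom R K α r : Matrix (Fin n) (Fin n) K) =
      Matrix.diagonal fun i => algebraMap R K (r i) := rfl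

variable (R K α) in
/-- The diagonal idempotent `e_i` of the order. -/
def diagIdem (i : Fin n) : order R K α :=
  diagHom R K α (Pi.single i 1)

theorem coe_diagIdem (i : Fin n) :
    (diagIdem R K α i : Matrix (Fin n) (Fin n) K) = Matrix.single i i 1 := by
  rw [diagIdem, coe_diagHom, ← Matrix.diagonal_single]
  congr 1
  ext j
  obtain rfl | h := eq_or_ne j i <;> simp [*]

variable (R K α) in
theorem completeOrthogonalIdempotents_diagIdem :
    CompleteOrthogonalIdempotents (diagIdem R K α) :=
  (CompleteOrthogonalIdempotents.single fun _ : Fin n => R).map (diagHom R K α).toRingHom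

theorem diagIdem_ne_zero (i : Fin n) : diagIdem R K α i ≠ 0 := by
  intro h
  simpa [coe_diagIdem] using congrFun₂ (congrArg Subtype.val h) i i

theorem diagResidue_diagIdem [FaithfulSMul R K] (hα : α.IsBasic) (k : Fin n) :
    diagResidue hα k (diagIdem R K α k) = 1 := by
  rw [diagResidue_apply, diagEntry_eq (r := 1) (by simp [coe_diagIdem]), map_one]

theorem exists_unit_symm_diagIdem_mul [FaithfulSMul R K] (hα : α.IsBasic) (φ : Aut R K α) :
    ∃ (u : (order R K α)ˣ) (τ : Equiv.Perm (Fin n)),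
      ∀ k, φ.symm (diagIdem R K α (τ k)) * u = u * diagIdem R K α k :=
  have he := completeOrthogonalIdempotents_diagIdem R K α
  exists_unit_mul_eq_mul (S := order R K α) (D := IsLocalRing.ResidueField R)
    (f := fun i => φ.symm (diagIdem R K α i)) (ρ := diagResidue hα)
    (fun _ => isUnit_of_diagResidue_ne_zero hα)
    he.toOrthogonalIdempotents (diagResidue_diagIdem hα)
    (he.map φ.symm.toRingEquiv.toRingHom)
    fun i => (map_ne_zero_iff _ φ.symm.injective).2 (diagIdem_ne_zero i)

theorem exists_isConjBy_unit_map_diagIdem [FaithfulSMul R K] (hα : α.IsBasic) (φ : Aut R K α) :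
    ∃ ι : Aut R K α, (∃ u : (order R K α)ˣ, IsConjBy ι (u : order R K α)) ∧
      ∃ τ : Equiv.Perm (Fin n), ∀ k, (φ * ι⁻¹) (diagIdem R K α k) = diagIdem R K α (τ k) := by
  obtain ⟨u, τ, hu⟩ := exists_unit_symm_diagIdem_mul hα φ
  obtain ⟨ι, hι⟩ := exists_isConjBy_unit u
  refine ⟨ι, ⟨u, hι⟩, τ, fun k => ?_⟩
  have hk : ι (φ.symm (diagIdem R K α (τ k))) = diagIdem R K α k := by
    rw [isConjBy_unit_iff.1 hι, mul_assoc, hu, Units.inv_mul_cancel_left]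
  rw [← hk]
  simp [AlgEquiv.aut_inv]

end DiagonalMatrices

section PermutesIdempotents

variable {R K : Type*} [CommRing R] [IsLocalRing R] [Field K] [Algebra R K] {n : ℕ}
  {α : ExponentMatrix n} {ψ : Aut R K α} {σ : Equiv.Perm (Fin n)}

theorem diagIdem_mul_mul_diagIdem_apply (a : order R K α) (i j : Fin n) :
    (diagIdem R K α i * a * diagIdem R K α j).1 = Matrix.single i j (a.1 i j) := by
  simp [coe_diagIdem, Matrix.single_mul_mul_single]

theorem mul_diagIdem_mul_apply (a b : order R K α) (i j k : Fin n) :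
    (a * diagIdem R K α k * b).1 i j = a.1 i k * b.1 k j := by
  simp [coe_diagIdem, Matrix.mul_apply, Matrix.single_apply, ite_and]

theorem map_apply_congr (hψ : ∀ i, ψ (diagIdem R K α i) = diagIdem R K α (σ i))
    {a b : order R K α} {i j : Fin n} (h : a.1 i j = b.1 i j) :
    (ψ a).1 (σ i) (σ j) = (ψ b).1 (σ i) (σ j) := by
  have hcorner : diagIdem R K α i * a * diagIdem R K α j =
      diagIdem R K α i * b * diagIdem R K α j :=
    Subtype.ext (by simp only [diagIdem_mul_mul_diagIdem_apply, h])
  have hmap := congrArg (fun c => (ψ c).1 (σ i) (σ j)) hcorner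
  simpa only [map_mul, hψ, diagIdem_mul_mul_diagIdem_apply, Matrix.single_apply_same] using hmap

theorem map_mul_diagIdem_mul_apply (hψ : ∀ i, ψ (diagIdem R K α i) = diagIdem R K α (σ i))
    (a b : order R K α) (i j k : Fin n) :
    (ψ (a * diagIdem R K α k * b)).1 i j = (ψ a).1 i (σ k) * (ψ b).1 (σ k) j := by
  rw [map_mul, map_mul, hψ, mul_diagIdem_mul_apply]

end PermutesIdempotents

section MonomialForm

variable {R K : Type*} [CommRing R] [IsDomain R] [IsDiscreteValuationRing R] [Field K]
  [Algebra R K] [FaithfulSMul R K] {n : ℕ} {α : ExponentMatrix n} {σ : Equiv.Perm (Fin n)}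

theorem exists_map_apply_eq_mul {ψ : Aut R K α}
    (hψ : ∀ i, ψ (diagIdem R K α i) = diagIdem R K α (σ i)) (i j : Fin n) :
    ∃ c ≠ 0, ∀ a : order R K α, (ψ a).1 (σ i) (σ j) = a.1 i j * c := by
  obtain ⟨ϖ, hϖ⟩ := IsDiscreteValuationRing.exists_irreducible R
  have h0 := algebraMap_ne_zero_of_irreducible (K := K) hϖ
  have hp : algebraMap R K ϖ ^ α.exp i j ≠ 0 := pow_ne_zero _ h0
  obtain ⟨g, hg⟩ := exists_apply_eq (pow_mem_primePow (K := K) hϖ (α.exp i j))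
  have hscale : ∀ a : order R K α, (ψ a).1 (σ i) (σ j) =
      a.1 i j * ((ψ g).1 (σ i) (σ j) / algebraMap R K ϖ ^ α.exp i j) := by
    intro a
    obtain ⟨r, hr⟩ := (mem_primePow_iff_exists hϖ).1 (a.2 i j)
    rw [map_apply_congr (b := r • g) hψ
      (by rw [hr, mul_comm, ← hg]; exact (Algebra.smul_def r _).symm), map_smul, hr]
    change r • (ψ g).1 (σ i) (σ j) = _
    rw [Algebra.smul_def]
    field_simp
  refine ⟨_, fun hc => ?_, hscale⟩
  obtain ⟨b, hb⟩ :=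
    exists_apply_eq (pow_mem_primePow (K := K) hϖ (α.exp (σ i) (σ j)))
  have hzero := hscale (ψ.symm b)
  rw [hc, mul_zero, ψ.apply_symm_apply, hb] at hzero
  exact pow_ne_zero _ h0 hzero

/- The entries of `ψ a` in the row of a base point `o` determine the scaling factors; the cocycle
identity for the other entries comes from applying `ψ` to `b * e_i * a`. -/
theorem exists_isConjBy_diagonal {ψ : Aut R K α}
    (hψ : ∀ i, ψ (diagIdem R K α i) = diagIdem R K α (σ i)) :
    ∃ c, IsConjBy ψ (Matrix.diagonal c * σ.permMatrix K) := by
  suffices ∃ c : Fin n → K, (∀ i, c i ≠ 0) ∧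
      ∀ (a : order R K α) i j, c i * (ψ a).1 (σ i) (σ j) = a.1 i j * c j by
    obtain ⟨c, hc0, hc⟩ := this
    exact ⟨c, isConjBy_iff.2 ⟨isUnit_diagonal_mul_permMatrix_iff.2 hc0,
      fun a => diagonal_mul_permMatrix_mul_eq_iff.2 (hc a)⟩⟩
  rcases isEmpty_or_nonempty (Fin n) with _ | ⟨⟨o⟩⟩
  · exact ⟨isEmptyElim, isEmptyElim, fun _ => isEmptyElim⟩
  choose c hc0 hc using exists_map_apply_eq_mul hψ o
  refine ⟨c, hc0, fun a i j => ?_⟩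
  obtain ⟨ϖ, hϖ⟩ := IsDiscreteValuationRing.exists_irreducible R
  obtain ⟨b, hb⟩ := exists_apply_eq (pow_mem_primePow (K := K) hϖ (α.exp o i))
  have hb0 : b.1 o i ≠ 0 := hb ▸ pow_ne_zero _ (algebraMap_ne_zero_of_irreducible hϖ)
  have h := hc j (b * diagIdem R K α i * a)
  rw [map_mul_diagIdem_mul_apply hψ, mul_diagIdem_mul_apply, hc i b] at h
  exact mul_left_cancel₀ hb0 (by rw [← mul_assoc, h, mul_assoc])

end MonomialForm

section ConjugationForm

variable {R K : Type*} [CommRing R] [IsDomain R] [IsDiscreteValuationRing R] [Field K]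
  [Algebra R K] [IsFractionRing R K] {ϖ : R} {n : ℕ} {α : ExponentMatrix n}

theorem exists_diagonal_eq_unit_mul_diagPow (hϖ : Irreducible ϖ) {c : Fin n → K}
    (hc : ∀ i, c i ≠ 0) : ∃ (u : (order R K α)ˣ) (x : Fin n → ℤ),
      Matrix.diagonal c = (u : order R K α).1 * diagPow K ϖ x := by
  choose x w hw using fun i =>
    IsDiscreteValuationRing.exists_units_eq_smul_zpow_of_irreducible hϖ (hc i)
  refine ⟨Units.map (diagHom R K α : (Fin n → R) →* order R K α) (MulEquiv.piUnits.symm w), x, ?_⟩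
  change _ = Matrix.diagonal _ * Matrix.diagonal _
  rw [Matrix.diagonal_mul_diagonal]
  congr 1
  ext i
  rw [hw i]
  exact Algebra.smul_def _ _

theorem exists_isConjBy_unit_mul_diagPow_mul_permMatrix (hϖ : Irreducible ϖ) (hα : α.IsBasic)
    (φ : Aut R K α) : ∃ (u : (order R K α)ˣ) (x : Fin n → ℤ) (σ : Equiv.Perm (Fin n)),
      IsConjBy φ ((u : order R K α) * (diagPow K ϖ x * σ.permMatrix K)) := by
  obtain ⟨ι, ⟨u, hι⟩, τ, hτ⟩ := exists_isConjBy_unit_map_diagIdem hα φ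
  obtain ⟨c, hc⟩ := exists_isConjBy_diagonal hτ
  obtain ⟨w, x, hw⟩ := exists_diagonal_eq_unit_mul_diagPow (α := α) hϖ
    (isUnit_diagonal_mul_permMatrix_iff.1 hc.1)
  refine ⟨u * w, x, τ, ?_⟩
  have hφ := hc.mul hι
  rw [inv_mul_cancel_right, hw] at hφ
  simpa only [Units.val_mul, MulMemClass.coe_mul, mul_assoc] using hφ

end ConjugationForm

section LinearSystem

variable {R K : Type*} [CommRing R] [IsDomain R] [IsDiscreteValuationRing R] [Field K]
  [Algebra R K] [FaithfulSMul R K] {ϖ : R} {n : ℕ} {α : ExponentMatrix n}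
  {σ : Equiv.Perm (Fin n)} {x : Fin n → ℤ}

theorem IsConjBy.exp_le {φ : Aut R K α} (hϖ : Irreducible ϖ)
    (hφ : IsConjBy φ (diagPow K ϖ x * σ.permMatrix K)) (i j : Fin n) :
    (α.exp (σ i) (σ j) : ℤ) ≤ α.exp i j - x i + x j := by
  have h0 := algebraMap_ne_zero_of_irreducible (K := K) hϖ
  obtain ⟨a, ha⟩ := exists_apply_eq (pow_mem_primePow (K := K) hϖ (α.exp i j))
  have h : algebraMap R K ϖ ^ x i * (φ a).1 (σ i) (σ j) = a.1 i j * algebraMap R K ϖ ^ x j :=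
    hφ.mul_apply_apply a i j
  rw [← zpow_mem_primePow_iff (K := K) hϖ]
  convert (φ a).2 (σ i) (σ j)
  rw [← mul_right_inj' (zpow_ne_zero (x i) h0), h, ha, ← zpow_natCast, ← zpow_add₀ h0,
    ← zpow_add₀ h0]
  congr 1
  ring

theorem IsConjBy.solves {φ : Aut R K α} (hϖ : Irreducible ϖ)
    (hφ : IsConjBy φ (diagPow K ϖ x * σ.permMatrix K)) : Solves α σ x := by
  intro i j
  have hinv := hφ.inv
  rw [inv_diagPow_mul_permMatrix hϖ] at hinv
  have hle := hφ.exp_le hϖ i j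
  have hge := hinv.exp_le hϖ (σ i) (σ j)
  simp only [Equiv.Perm.coe_inv, Equiv.symm_apply_apply, Pi.neg_apply, Function.comp_apply] at hge
  omega

theorem IsConjBy.solves_of_unit_mul {φ : Aut R K α} {u : (order R K α)ˣ} (hϖ : Irreducible ϖ)
    (hφ : IsConjBy φ ((u : order R K α) * diagPow K ϖ x * σ.permMatrix K)) : Solves α σ x := by
  rw [mul_assoc] at hφ
  obtain ⟨θ, -, hθ, -⟩ := hφ.exists_eq_mul_inn
  exact hθ.solves hϖ

theorem exists_isConjBy_of_solves (hϖ : Irreducible ϖ) (hx : Solves α σ x) :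
    ∃ φ : Aut R K α, IsConjBy φ (diagPow K ϖ x * σ.permMatrix K) := by
  have h0 := algebraMap_ne_zero_of_irreducible (K := K) hϖ
  refine exists_isConjBy (isUnit_diagPow_mul_permMatrix hϖ x σ) fun A B hAB => ?_
  have hentry := diagonal_mul_permMatrix_mul_eq_iff.1 hAB
  change (∀ i j, _) ↔ ∀ i j, _
  rw [← σ.forall_congr_right]
  refine forall_congr' fun i => ?_
  rw [← σ.forall_congr_right]
  refine forall_congr' fun j => ?_
  have hA : A i j = algebraMap R K ϖ ^ (x i - x j) * B (σ i) (σ j) := by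
    rw [zpow_sub₀ h0, div_mul_eq_mul_div, eq_div_iff (zpow_ne_zero _ h0)]
    exact (hentry i j).symm
  rw [hA, zpow_mul_mem_primePow_iff hϖ]
  have := hx i j
  omega

theorem Solves.of_forall_lt {y : Fin n → ℤ} (hy : Solves α σ y)
    (hx : ∀ i j, i < j → x i - x j = (α.exp i j : ℤ) - α.exp (σ i) (σ j)) : Solves α σ x := by
  intro i j
  rcases lt_trichotomy i j with h | rfl | h
  · exact hx i j h
  · simp [α.diag]
  · have := hx j i h
    have := hy j i
    have := hy i j
    omega

end LinearSystem

section Induces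

variable {R K : Type*} [CommRing R] [IsLocalRing R] [Field K] [Algebra R K] {n : ℕ}
  {α : ExponentMatrix n} {φ ψ : Aut R K α} {σ τ : Equiv.Perm (Fin n)}

theorem Induces.mul (hφ : Induces φ σ) (hψ : Induces ψ τ) : Induces (φ * ψ) (σ * τ) :=
  fun i a => (hφ (τ i) (ψ a)).trans (hψ i a)

theorem IsConjBy.induces {c : Fin n → K}
    (hφ : IsConjBy φ (Matrix.diagonal c * σ.permMatrix K)) : Induces φ σ := by
  intro i a
  have h := hφ.mul_apply_apply a i i
  rw [mul_comm, mul_left_inj' (isUnit_diagonal_mul_permMatrix_iff.1 hφ.1 i)] at h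
  rw [mem_maxIdeal_iff, mem_maxIdeal_iff, h]

theorem induces_one_of_mem_inn [FaithfulSMul R K] (hα : α.IsBasic) (h : φ ∈ inn R K α) :
    Induces φ 1 := by
  obtain ⟨u, hu⟩ := mem_inn_iff.1 h
  intro i a
  rw [← diagResidue_eq_zero_iff hα, ← diagResidue_eq_zero_iff hα, isConjBy_unit_iff.1 hu, map_mul,
    map_mul, mul_right_comm, ← map_mul]
  simp

theorem Induces.unique [FaithfulSMul R K] (hσ : Induces φ σ) (hτ : Induces φ τ) : σ = τ := by
  have hidem : ∀ i k, (diagIdem R K α k).1 ∈ maxIdeal R K α i ↔ i ≠ k := by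
    intro i k
    rw [mem_maxIdeal_iff, coe_diagIdem]
    by_cases h : i = k
    · simpa [h] using one_notMem_primePow_one
    · simp [h, Ne.symm h]
  ext i
  by_contra hne
  have hmem : (diagIdem R K α (τ i)).1 ∈ maxIdeal R K α (σ i) :=
    (hidem _ _).2 fun h => hne (congrArg Fin.val h)
  rw [← φ.apply_symm_apply (diagIdem R K α (τ i)), hσ, ← hτ, φ.apply_symm_apply] at hmem
  exact (hidem _ _).1 hmem rfl

variable (R K α) in
/-- `M_k` as a submodule of the order. -/
def maxIdealIn (k : Fin n) : Submodule R (order R K α) :=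
  (maxIdeal R K α k).comap (order R K α).val.toLinearMap

theorem map_mul_eq_map_inf_iff {S A B : Type*} [CommSemiring S] [Semiring A] [Semiring B]
    [Algebra S A] [Algebra S B] {f : A →ₐ[S] B} (hf : Function.Injective f) {M N : Submodule S A} :
    M.map f.toLinearMap * N.map f.toLinearMap = M.map f.toLinearMap ⊓ N.map f.toLinearMap ↔
      M * N = M ⊓ N := by
  rw [← Submodule.map_mul, ← Submodule.map_inf f.toLinearMap hf,
    (Submodule.map_injective_of_injective hf).eq_iff]

theorem map_val_maxIdealIn (k : Fin n) :
    (maxIdealIn R K α k).map (order R K α).val.toLinearMap = maxIdeal R K α k := by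
  rw [maxIdealIn, Submodule.map_comap_eq, inf_eq_right]
  refine fun A hA => ⟨⟨A, fun i j => primePow_antitone ?_ (hA i j)⟩, rfl⟩
  dsimp only
  split_ifs with h
  · rw [h.1, h.2, α.diag]
    exact Nat.zero_le 1
  · exact le_rfl

theorem linkArrow_iff {i j : Fin n} : LinkArrow R K α i j ↔
    maxIdealIn R K α j * maxIdealIn R K α i ≠ maxIdealIn R K α j ⊓ maxIdealIn R K α i := by
  rw [LinkArrow, ← map_val_maxIdealIn i, ← map_val_maxIdealIn j]
  exact (map_mul_eq_map_inf_iff Subtype.val_injective).not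

theorem Induces.map_maxIdealIn (h : Induces φ σ) (k : Fin n) :
    (maxIdealIn R K α k).map φ.toAlgHom.toLinearMap = maxIdealIn R K α (σ k) := by
  ext b
  constructor
  · rintro ⟨a, ha, rfl⟩
    exact (h k a).2 ha
  · exact fun hb => ⟨φ.symm b, (h k _).1 (by rwa [φ.apply_symm_apply]), φ.apply_symm_apply b⟩

theorem Induces.linkArrow_iff (h : Induces φ σ) {i j : Fin n} :
    LinkArrow R K α (σ i) (σ j) ↔ LinkArrow R K α i j := by
  rw [TiledOrder.linkArrow_iff, TiledOrder.linkArrow_iff, ← h.map_maxIdealIn,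
    ← h.map_maxIdealIn]
  exact (map_mul_eq_map_inf_iff φ.injective).not

/-- The automorphism of the link graph given by a permutation that `φ` induces. -/
def Induces.linkAut (h : Induces φ σ) : LinkAut R K α := ⟨σ, h.linkArrow_iff⟩

end Induces

section MainResults

variable {R K : Type*} [CommRing R] [IsDomain R] [IsDiscreteValuationRing R] [Field K]
  [Algebra R K] {ϖ : R} {n : ℕ} {α : ExponentMatrix n}

theorem mem_liftSet_iff [FaithfulSMul R K] (hϖ : Irreducible ϖ) {φ : Aut R K α} :
    φ ∈ liftSet K ϖ α ↔ ∃ (σ : Equiv.Perm (Fin n)) (x : Fin n → ℤ),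
      IsConjBy φ (diagPow K ϖ x * σ.permMatrix K) := by
  constructor
  · rintro ⟨σ, -, x, -, hφ⟩
    exact ⟨σ.toEquiv, x, hφ⟩
  · rintro ⟨σ, x, hφ⟩
    exact ⟨hφ.induces.linkAut, ⟨φ, hφ.induces⟩, x, hφ.solves hϖ, hφ⟩

/- For `σ = 1` the solutions of the system are the constant vectors, and then `d(x)` is scalar. -/
theorem eq_one_of_mem_liftSet_of_mem_inn [FaithfulSMul R K] (hϖ : Irreducible ϖ)
    (hα : α.IsBasic) {φ : Aut R K α} (hO : φ ∈ liftSet K ϖ α) (hinn : φ ∈ inn R K α) : φ = 1 := by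
  obtain ⟨σ, x, hφ⟩ := (mem_liftSet_iff hϖ).1 hO
  obtain rfl : σ = 1 := hφ.induces.unique (induces_one_of_mem_inn hα hinn)
  have hconst : ∀ i j, x i = x j := fun i j => by simpa [sub_eq_zero] using hφ.solves hϖ i j
  ext a i j
  have h : algebraMap R K ϖ ^ x i * (φ a).1 i j = a.1 i j * algebraMap R K ϖ ^ x j :=
    hφ.mul_apply_apply a i j
  rw [hconst i j, mul_comm] at h
  exact mul_right_cancel₀ (zpow_ne_zero _ (algebraMap_ne_zero_of_irreducible hϖ)) h

variable (K α) in
/-- `O_Λ` as a subgroup of `Aut_R(Λ)`. -/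
def liftSubgroup [FaithfulSMul R K] (hϖ : Irreducible ϖ) : Subgroup (Aut R K α) where
  carrier := liftSet K ϖ α
  one_mem' := (mem_liftSet_iff hϖ).2 ⟨1, 0, by simpa [diagPow] using isConjBy_one⟩
  mul_mem' {φ ψ} hφ hψ := by
    obtain ⟨σ, x, hφ⟩ := (mem_liftSet_iff hϖ).1 hφ
    obtain ⟨τ, y, hψ⟩ := (mem_liftSet_iff hϖ).1 hψ
    exact (mem_liftSet_iff hϖ).2 ⟨σ * τ, y + x ∘ τ,
      diagPow_mul_permMatrix_mul (K := K) hϖ y x τ σ ▸ hφ.mul hψ⟩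
  inv_mem' {φ} hφ := by
    obtain ⟨σ, x, hφ⟩ := (mem_liftSet_iff hϖ).1 hφ
    exact (mem_liftSet_iff hϖ).2 ⟨σ⁻¹, -x ∘ σ.symm,
      inv_diagPow_mul_permMatrix (K := K) hϖ x σ ▸ hφ.inv⟩

variable [IsFractionRing R K]

theorem exists_mem_liftSet_mul_mem_inn (hϖ : Irreducible ϖ) (hα : α.IsBasic) (φ : Aut R K α) :
    ∃ θ ∈ liftSet K ϖ α, ∃ ι ∈ inn R K α, φ = θ * ι := by
  obtain ⟨u, x, σ, hφ⟩ := exists_isConjBy_unit_mul_diagPow_mul_permMatrix hϖ hα φ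
  obtain ⟨θ, ι, hθ, hι, rfl⟩ := hφ.exists_eq_mul_inn
  exact ⟨θ, (mem_liftSet_iff hϖ).2 ⟨σ, x, hθ⟩, ι, hι, rfl⟩

theorem exists_induces_iff_exists_solves (hα : α.IsBasic) {σ : Equiv.Perm (Fin n)} :
    (∃ φ : Aut R K α, Induces φ σ) ↔ ∃ x : Fin n → ℤ, Solves α σ x := by
  obtain ⟨ϖ, hϖ⟩ := IsDiscreteValuationRing.exists_irreducible R
  constructor
  · rintro ⟨φ, hσ⟩
    obtain ⟨θ, hθ, ι, hι, rfl⟩ := exists_mem_liftSet_mul_mem_inn hϖ hα φ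
    obtain ⟨τ, x, hθ⟩ := (mem_liftSet_iff hϖ).1 hθ
    have hτ : Induces (θ * ι) (τ * 1) := hθ.induces.mul (induces_one_of_mem_inn hα hι)
    rw [hσ.unique hτ, mul_one]
    exact ⟨x, hθ.solves hϖ⟩
  · rintro ⟨x, hx⟩
    obtain ⟨φ, hφ⟩ := exists_isConjBy_of_solves (K := K) hϖ hx
    exact ⟨φ, hφ.induces⟩

theorem isComplement'_inn_liftSubgroup (hϖ : Irreducible ϖ) (hα : α.IsBasic) :
    (inn R K α).IsComplement' (liftSubgroup K α hϖ) := by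
  refine (Subgroup.isComplement'_of_disjoint_and_mul_eq_univ ?_ ?_).symm
  · rw [Subgroup.disjoint_def]
    exact eq_one_of_mem_liftSet_of_mem_inn hϖ hα
  · refine Set.eq_univ_of_forall fun φ => ?_
    obtain ⟨θ, hθ, ι, hι, rfl⟩ := exists_mem_liftSet_mul_mem_inn hϖ hα φ
    exact Set.mul_mem_mul hθ hι

end MainResults

end TiledOrder

theorem theorem5_general {R K : Type*} [CommRing R] [IsDomain R] [IsDiscreteValuationRing R]
    [Field K] [Algebra R K] [IsFractionRing R K]
    (ϖ : R) (hϖ : Irreducible ϖ) {n : ℕ} (α : ExponentMatrix n) (hα : α.IsBasic) :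
    (∀ σ : Equiv.Perm (Fin n),
      (∃ φ : Aut R K α, Induces φ σ) ↔ ∃ x : Fin n → ℤ, Solves α σ x) ∧
    (∀ σ : Equiv.Perm (Fin n), (∃ φ : Aut R K α, Induces φ σ) → ∀ x : Fin n → ℤ,
      (∀ i j, i < j → x i - x j = (α.exp i j : ℤ) - (α.exp (σ i) (σ j) : ℤ)) →
      ∃ φ : Aut R K α, IsConjBy φ (diagPow K ϖ x * σ.permMatrix K)) ∧
    (∀ (φ : Aut R K α) (u : (order R K α)ˣ) (d : Fin n → ℤ) (σ : Equiv.Perm (Fin n)),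
      IsConjBy φ ((u : order R K α) * diagPow K ϖ d * σ.permMatrix K) → Solves α σ d) ∧
    (∃ O : Subgroup (Aut R K α), (O : Set (Aut R K α)) = liftSet K ϖ α ∧
      (inn R K α).Normal ∧ (inn R K α).IsComplement' O) := by
  refine ⟨fun σ => exists_induces_iff_exists_solves hα, fun σ hσ x hx => ?_,
    fun φ u d σ hφ => hφ.solves_of_unit_mul hϖ,
    liftSubgroup K α hϖ, rfl, inn_normal α, isComplement'_inn_liftSubgroup hϖ hα⟩
  obtain ⟨y, hy⟩ := (exists_induces_iff_exists_solves hα).1 hσ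
  exact exists_isConjBy_of_solves hϖ (hy.of_forall_lt hx)

theorem theorem5 {R K : Type*} [CommRing R] [IsDomain R] [IsDiscreteValuationRing R]
    [IsAdicComplete (IsLocalRing.maximalIdeal R) R]
    [Field K] [Algebra R K] [IsFractionRing R K]
    (ϖ : R) (hϖ : Irreducible ϖ) {n : ℕ} (α : ExponentMatrix n) (hα : α.IsBasic) :
    -- (a)
    (∀ σ : LinkAut R K α, Liftable σ ↔ ∃ x : Fin n → ℤ, Solves α σ.toEquiv x) ∧
    -- (b), needing only the equations with i < j
    (∀ σ : LinkAut R K α, Liftable σ → ∀ x : Fin n → ℤ,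
      (∀ i j, i < j →
        x i - x j = (α.exp i j : ℤ) - (α.exp (σ.toEquiv i) (σ.toEquiv j) : ℤ)) →
      ∃ φ : Aut R K α, IsConjBy φ (diagPow K ϖ x * Equiv.Perm.permMatrix K σ.toEquiv)) ∧
    -- (c)
    (∀ (φ : Aut R K α) (u : (order R K α)ˣ) (d : Fin n → ℤ) (σ : Equiv.Perm (Fin n)),
      IsConjBy φ ((u : order R K α) * diagPow K ϖ d * Equiv.Perm.permMatrix K σ) → Solves α σ d) ∧
    -- (d)
    (∃ O : Subgroup (Aut R K α), (O : Set (Aut R K α)) = liftSet K ϖ α ∧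
      (inn R K α).Normal ∧ (inn R K α).IsComplement' O) := by
  have h := theorem5_general ϖ hϖ α hα (K := K)
  exact ⟨fun σ => h.1 σ.toEquiv, fun σ => h.2.1 σ.toEquiv, h.2.2⟩
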